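/- All spaces are Hausdorff. For a locally compact paracompact space $X$ let $\beta X$ be its Stone–Čech compactification (with $X\subseteq\beta X$), let $C^*(X)$ be the ring of bounded continuous functions $X\to\mathbb R$, and let $$\sigma X=\bigcup\{\mathrm{cl}_{\beta X}A : A\subseteq X \text{ is } \sigma\text{-compact}\}.$$ A sequence $\mathcal U=\{U_n\}_{n<\omega}$ of open subsets of $X$ is called $\sigma$-regular if for every $n<\omega$ the set $\mathrm{cl}_XU_n$ is $\sigma$-compact and non-compact and $U_n\supseteq\mathrm{cl}_XU_{n+1}$. For such $\mathcal U$ let $I_{\mathcal U}$ be the ideal of $C^*(X)$ consisting of all $g\in C^*(X)$ such that for every $\epsilon>0$ the set $|g|^{-1}([\epsilon,\infty))\cap\mathrm{cl}_XU_n$ is compact for some $n<\omega$, and put $$\Omega_X=\{I_{\mathcal U}:\mathcal U\text{ is a }\sigma\text{-regular sequence of open sets in }X\}.$$ For an open set $E\subseteq X$ let $I_E$ be the ideal of $C^*(X)$ consisting of all $g$ such that $|g|^{-1}([\epsilon,\infty))\setminus E$ is compact for every $\epsilon>0$, and put $$\Sigma_X=\{I_U:U\subseteq X\text{ clopen and }\sigma\text{-compact}\},\qquad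 \Delta_X=\{I_{X\setminus U}:U\subseteq X\text{ clopen, }\sigma\text{-compact and non-compact}\}.$$ **Theorem.** Let $X$ and $Y$ be locally compact paracompact non-$\sigma$-compact spaces. Then the following are equivalent: 1. $(\Omega_X,\subseteq)$ and $(\Omega_Y,\subseteq)$ are order-isomorphic; 2. $\sigma X\setminus X$ and $\sigma Y\setminus Y$ are homeomorphic (as subspaces of $\beta X$ and $\beta Y$). If, moreover, $X$ and $Y$ are zero-dimensional (their clopen subsets form a base), then the following are equivalent: 1. $(\Sigma_X,\subseteq)$ and $(\Sigma_Y,\subseteq)$ are order-isomorphic; 2. $(\Delta_X,\subseteq)$ and $(\Delta_Y,\subseteq)$ are order-isomorphic; 3. $\sigma X\setminus X$ and $\sigma Y\setminus Y$ are homeomorphic. -/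

import Mathlib

open Set TopologicalSpace
open scoped BoundedContinuousFunction

namespace OnePointIdeals

universe u

/-- The subspace `σX` of the Stone-Čech compactification `βX`: the union of the closures in `βX`
of all σ-compact subsets of `X`. -/
def sigmaPart (X : Type u) [TopologicalSpace X] : Set (StoneCech X) :=
  ⋃ A ∈ {A : Set X | IsSigmaCompact A}, closure (stoneCechUnit '' A)

/-- The set `σX \ X`, where `X` is identified with its canonical image in `βX`; as a type it carries
the subspace topology inherited from `βX`. -/
def sigmaRemainder (X : Type u) [TopologicalSpace X] : Set (StoneCech X) :=
  sigmaPart X \ range (stoneCechUnit : X → StoneCech X)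

/-- A σ-regular sequence of open sets: every `U n` is open, its closure is σ-compact and
non-compact, and `U n` contains the closure of `U (n + 1)`. -/
structure IsSigmaRegular {X : Type u} [TopologicalSpace X] (U : ℕ → Set X) : Prop where
  isOpen : ∀ n, IsOpen (U n)
  isSigmaCompact_closure : ∀ n, IsSigmaCompact (closure (U n))
  not_isCompact_closure : ∀ n, ¬ IsCompact (closure (U n))
  closure_succ_subset : ∀ n, closure (U (n + 1)) ⊆ U n

section helpers

variable {X : Type u} [TopologicalSpace X]

theorem IsSigmaRegular.antitone_closure {U : ℕ → Set X} (hU : IsSigmaRegular U) :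
    Antitone fun n => closure (U n) :=
  antitone_nat_of_succ_le fun n => (hU.closure_succ_subset n).trans subset_closure

theorem isClosed_level (g : X →ᵇ ℝ) (ε : ℝ) : IsClosed {x | ε ≤ |g x|} :=
  isClosed_le continuous_const (continuous_abs.comp g.continuous)

theorem level_add_subset (f g : X →ᵇ ℝ) (ε : ℝ) :
    {x | ε ≤ |(f + g) x|} ⊆ {x | ε / 2 ≤ |f x|} ∪ {x | ε / 2 ≤ |g x|} := by
  intro x hx
  by_contra h
  simp only [mem_union, mem_ofPred_eq, not_or, not_le, BoundedContinuousFunction.coe_add,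
    Pi.add_apply] at h hx
  have := abs_add_le (f x) (g x)
  linarith [h.1, h.2]

theorem level_mul_subset (h g : X →ᵇ ℝ) {ε : ℝ} :
    {x | ε ≤ |(h * g) x|} ⊆ {x | ε / (‖h‖ + 1) ≤ |g x|} := by
  intro x hx
  simp only [mem_ofPred_eq, BoundedContinuousFunction.coe_mul, Pi.mul_apply, abs_mul] at hx ⊢
  have h1 : |h x| ≤ ‖h‖ := h.norm_coe_le_norm x
  have h2 : 0 < ‖h‖ + 1 := by positivity
  rw [div_le_iff₀ h2]
  nlinarith [abs_nonneg (g x)]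

end helpers

/-- The ideal `I_𝒰` of `C*(X)` given by a σ-regular sequence `𝒰` of open sets: all bounded
continuous `g : X → ℝ` such that for every `ε > 0` the set `{|g| ≥ ε} ∩ closure (U n)` is compact
for some `n`. -/
def seqIdeal {X : Type u} [TopologicalSpace X] (U : ℕ → Set X) (hU : IsSigmaRegular U) :
    Ideal (X →ᵇ ℝ) where
  carrier := {g | ∀ ε : ℝ, 0 < ε → ∃ n, IsCompact ({x | ε ≤ |g x|} ∩ closure (U n))}
  zero_mem' := by
    intro ε hε
    refine ⟨0, ?_⟩
    have : {x : X | ε ≤ |(0 : X →ᵇ ℝ) x|} = ∅ := by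
      ext x; simpa using hε
    rw [this]; simp
  add_mem' := by
    intro f g hf hg ε hε
    obtain ⟨m, hm⟩ := hf (ε / 2) (by positivity)
    obtain ⟨n, hn⟩ := hg (ε / 2) (by positivity)
    refine ⟨max m n, (hm.union hn).of_isClosed_subset
      ((isClosed_level _ _).inter isClosed_closure) ?_⟩
    rintro x ⟨hx, hxU⟩
    rcases level_add_subset f g ε hx with h | h
    · exact Or.inl ⟨h, hU.antitone_closure (le_max_left m n) hxU⟩
    · exact Or.inr ⟨h, hU.antitone_closure (le_max_right m n) hxU⟩
  smul_mem' := by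
    intro h g hg ε hε
    obtain ⟨n, hn⟩ := hg (ε / (‖h‖ + 1)) (by positivity)
    exact ⟨n, hn.of_isClosed_subset ((isClosed_level _ _).inter isClosed_closure)
      (inter_subset_inter_left _ (level_mul_subset h g))⟩

/-- The ideal `I_E` of `C*(X)` for an open set `E`: all bounded continuous `g : X → ℝ` such that
`{|g| ≥ ε} \ E` is compact for every `ε > 0`. -/
def openIdeal {X : Type u} [TopologicalSpace X] (E : Opens X) : Ideal (X →ᵇ ℝ) where
  carrier := {g | ∀ ε : ℝ, 0 < ε → IsCompact ({x | ε ≤ |g x|} \ (E : Set X))}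
  zero_mem' := by
    intro ε hε
    have : {x : X | ε ≤ |(0 : X →ᵇ ℝ) x|} = ∅ := by
      ext x; simpa using hε
    rw [this]; simp
  add_mem' := by
    intro f g hf hg ε hε
    refine ((hf (ε / 2) (by positivity)).union (hg (ε / 2) (by positivity))).of_isClosed_subset
      ((isClosed_level _ _).sdiff E.isOpen) ?_
    rintro x ⟨hx, hxE⟩
    rcases level_add_subset f g ε hx with h | h
    · exact Or.inl ⟨h, hxE⟩
    · exact Or.inr ⟨h, hxE⟩
  smul_mem' := by
    intro h g hg ε hε
    exact (hg (ε / (‖h‖ + 1)) (by positivity)).of_isClosed_subset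
      ((isClosed_level _ _).sdiff E.isOpen) (sdiff_subset_sdiff_left (level_mul_subset h g))

/-- `Ω_X`: the set of all ideals `I_𝒰`, for `𝒰` a σ-regular sequence of open sets in `X`. -/
def OmegaIdeals (X : Type u) [TopologicalSpace X] : Set (Ideal (X →ᵇ ℝ)) :=
  {I | ∃ (U : ℕ → Set X) (hU : IsSigmaRegular U), I = seqIdeal U hU}

/-- `Σ_X`: the set of all ideals `I_U`, for `U` a σ-compact clopen subset of `X`. -/
def SigmaIdeals (X : Type u) [TopologicalSpace X] : Set (Ideal (X →ᵇ ℝ)) :=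
  {I | ∃ U : Clopens X, IsSigmaCompact (U : Set X) ∧ I = openIdeal U.toOpens}

/-- `Δ_X`: the set of all ideals `I_{X \ U}`, for `U` a σ-compact non-compact clopen subset
of `X`. -/
def DeltaIdeals (X : Type u) [TopologicalSpace X] : Set (Ideal (X →ᵇ ℝ)) :=
  {I | ∃ U : Clopens X, IsSigmaCompact (U : Set X) ∧ ¬ IsCompact (U : Set X) ∧
    I = openIdeal (Uᶜ).toOpens}

/-- `X` is zero-dimensional: its clopen subsets form a base of the topology. -/
def IsZeroDimensional (X : Type u) [TopologicalSpace X] : Prop :=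
  IsTopologicalBasis {s : Set X | IsClopen s}

end OnePointIdeals

namespace OnePointIdeals

universe u v w

/-! Each ideal in question consists of the functions whose extension to `βX` vanishes on a certain
closed subset of `βX \ X`, and by Urysohn's lemma in `βX` inclusion of such ideals is reverse
inclusion of the closed sets (`vanishIdeal_le_iff`). So the ordered sets of ideals become ordered
families of subsets of the remainder `T = σX \ X`: `Ω_X` is the nonempty compact Gδ sets reversed,
and in the zero-dimensional case `Δ_X` is the nonempty compact open sets reversed, while `Σ_X`,
whose zero sets are complements in `βX \ X`, is the compact open sets in their own order.

A homeomorphism of remainders preserves these families. Conversely, a locally compact Hausdorff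
space is determined by the inclusion order on any family of nonempty compact sets that separates
disjoint compact sets (`IsSeparatingFamily.nonempty_homeomorph`).

Paracompactness puts every σ-compact set inside a clopen σ-compact one. Hence `σX` is open in `βX`,
`T` is locally compact, and every compact subset of `T` lies in the closure of a single clopen
σ-compact set. -/

/-! ### Recovering a locally compact space from an ordered family of compact sets -/

/-- A family of nonempty compact sets, closed under nonempty binary intersections, that separates
disjoint compact sets. -/
structure IsSeparatingFamily {T : Type v} [TopologicalSpace T] (B : Set (Set T)) : Prop where
  isCompact : ∀ K ∈ B, IsCompact K
  nonempty : ∀ K ∈ B, K.Nonempty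
  inter_mem : ∀ K ∈ B, ∀ L ∈ B, (K ∩ L).Nonempty → K ∩ L ∈ B
  exists_superset : ∀ C D : Set T, IsCompact C → C.Nonempty → IsCompact D → Disjoint C D →
    ∃ K ∈ B, C ⊆ K ∧ Disjoint K D

/-- A bijection under which preimages of compact sets and images of compact sets are compact is
continuous when the domain is locally compact. -/
theorem continuous_of_isCompact_image {T : Type v} {T' : Type w} [TopologicalSpace T]
    [TopologicalSpace T'] [T2Space T] [T2Space T'] [LocallyCompactSpace T] (e : T ≃ T')
    (h1 : ∀ C : Set T, IsCompact C → IsCompact (e '' C))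
    (h2 : ∀ C : Set T', IsCompact C → IsCompact (e.symm '' C)) : Continuous e := by
  refine continuous_iff_isClosed.2 fun C hC => ?_
  rw [CompactlyCoherentSpace.isClosed_iff]
  intro K hK
  have h : e.symm '' (C ∩ e '' K) = K ∩ e ⁻¹' C := by
    ext x; simp [e.symm.image_eq_preimage_symm, and_comm]
  have h3 : IsClosed (K ∩ e ⁻¹' C) := h ▸ (h2 _ ((h1 K hK).inter_left hC)).isClosed
  have h4 := h3.preimage (continuous_subtype_val : Continuous ((↑) : K → T))
  convert! h4 using 1
  ext x; simp

namespace IsSeparatingFamily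

variable {T : Type v} {T' : Type w} [TopologicalSpace T] [TopologicalSpace T']
  {B : Set (Set T)} {B' : Set (Set T')}

theorem exists_mem (hB : IsSeparatingFamily B) (x : T) : ∃ K : B, x ∈ (K : Set T) := by
  obtain ⟨K, hK, hxK, -⟩ := hB.exists_superset {x} ∅ isCompact_singleton (singleton_nonempty x)
    isCompact_empty (disjoint_empty _)
  exact ⟨⟨K, hK⟩, hxK rfl⟩

theorem mem_iff_forall (hB : IsSeparatingFamily B) {C : Set T} (hC : IsCompact C)
    (hne : C.Nonempty) (x : T) : x ∈ C ↔ ∀ K : B, C ⊆ K → x ∈ (K : Set T) := by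
  refine ⟨fun hx K hK => hK hx, fun h => by_contra fun hx => ?_⟩
  obtain ⟨K, hK, hCK, hd⟩ := hB.exists_superset C {x} hC hne isCompact_singleton
    (disjoint_singleton_right.2 hx)
  exact disjoint_singleton_right.1 hd (h ⟨K, hK⟩ hCK)

theorem eq_of_forall_mem (hB : IsSeparatingFamily B) {x y : T}
    (h : ∀ K : B, x ∈ (K : Set T) → y ∈ (K : Set T)) : y = x :=
  (hB.mem_iff_forall isCompact_singleton (singleton_nonempty x) y).2
    fun K hK => h K (hK rfl)

/-- The members containing `x` are directed downwards, so by monotonicity of `φ` their images are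
too; nonempty compact sets so directed have a common point. -/
theorem exists_forall_mem_imp [T2Space T'] (hB : IsSeparatingFamily B)
    (hB' : IsSeparatingFamily B') (φ : B ≃o B') (x : T) :
    ∃ y : T', ∀ K : B, x ∈ (K : Set T) → y ∈ (φ K : Set T') := by
  let ι := {K : B // x ∈ (K : Set T)}
  have : Nonempty ι := (hB.exists_mem x).elim fun K hK => ⟨⟨K, hK⟩⟩
  have hdir : Directed (· ⊇ ·) fun K : ι => (φ K.1 : Set T') := by
    rintro ⟨K, hK⟩ ⟨L, hL⟩
    refine ⟨⟨⟨K ∩ L, hB.inter_mem _ K.2 _ L.2 ⟨x, hK, hL⟩⟩, hK, hL⟩, ?_, ?_⟩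
    · exact φ.monotone (show (⟨(K : Set T) ∩ L, _⟩ : B) ≤ K from inter_subset_left)
    · exact φ.monotone (show (⟨(K : Set T) ∩ L, _⟩ : B) ≤ L from inter_subset_right)
  obtain ⟨y, hy⟩ := IsCompact.nonempty_iInter_of_directed_nonempty_isCompact_isClosed _ hdir
    (fun K => hB'.nonempty _ (φ K.1).2) (fun K => hB'.isCompact _ (φ K.1).2)
    (fun K => (hB'.isCompact _ (φ K.1).2).isClosed)
  exact ⟨y, fun K hK => mem_iInter.1 hy ⟨K, hK⟩⟩

theorem exists_forall_mem_iff [T2Space T] [T2Space T'] (hB : IsSeparatingFamily B)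
    (hB' : IsSeparatingFamily B') (φ : B ≃o B') (x : T) :
    ∃ y : T', ∀ K : B, x ∈ (K : Set T) ↔ y ∈ (φ K : Set T') := by
  obtain ⟨y, hy⟩ := hB.exists_forall_mem_imp hB' φ x
  obtain ⟨z, hz⟩ := hB'.exists_forall_mem_imp hB φ.symm y
  -- Going forth and back returns to `x`, which turns the implication into an equivalence.
  have hzx : z = x := hB.eq_of_forall_mem fun K hK => by simpa using hz _ (hy K hK)
  subst hzx
  exact ⟨y, fun K => ⟨hy K, fun h => by simpa using hz _ h⟩⟩

/-- A nonempty compact set is the intersection of the members containing it, so its image is the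
intersection of the corresponding compact members of `B'`. -/
theorem isCompact_image [T2Space T] [T2Space T'] (hB : IsSeparatingFamily B)
    (hB' : IsSeparatingFamily B') (φ : B ≃o B') (e : T ≃ T')
    (he : ∀ x (K : B), x ∈ (K : Set T) ↔ e x ∈ (φ K : Set T')) {C : Set T} (hC : IsCompact C) :
    IsCompact (e '' C) := by
  rcases C.eq_empty_or_nonempty with rfl | hne
  · simp
  obtain ⟨K₀, hK₀, hCK₀, -⟩ := hB.exists_superset C ∅ hC hne isCompact_empty (disjoint_empty _)
  have h : e '' C = ⋂ K : {K : B // C ⊆ K}, (φ K.1 : Set T') := by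
    ext y
    obtain ⟨x, rfl⟩ := e.surjective y
    rw [e.injective.mem_set_image, hB.mem_iff_forall hC hne]
    simp only [he, mem_iInter, Subtype.forall]
  rw [h]
  exact (hB'.isCompact _ (φ ⟨K₀, hK₀⟩).2).of_isClosed_subset
    (isClosed_iInter fun K => (hB'.isCompact _ (φ K.1).2).isClosed)
    (iInter_subset (fun K : {K : B // C ⊆ K} => (φ K.1 : Set T')) ⟨⟨K₀, hK₀⟩, hCK₀⟩)

theorem nonempty_homeomorph [T2Space T] [T2Space T'] [LocallyCompactSpace T]
    [LocallyCompactSpace T'] (hB : IsSeparatingFamily B)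
    (hB' : IsSeparatingFamily B') (φ : B ≃o B') : Nonempty (T ≃ₜ T') := by
  choose f hf using hB.exists_forall_mem_iff hB' φ
  choose g hg using hB'.exists_forall_mem_iff hB φ.symm
  let e : T ≃ T' :=
    { toFun := f
      invFun := g
      left_inv := fun x => hB.eq_of_forall_mem fun K hK => by
        simpa using (hg (f x) (φ K)).1 ((hf x K).1 hK)
      right_inv := fun y => hB'.eq_of_forall_mem fun K hK => by
        simpa using (hf (g y) (φ.symm K)).1 ((hg y K).1 hK) }
  have h1 : ∀ C : Set T, IsCompact C → IsCompact (e '' C) :=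
    fun C => hB.isCompact_image hB' φ e hf
  have h2 : ∀ C : Set T', IsCompact C → IsCompact (e.symm '' C) :=
    fun C => hB'.isCompact_image hB φ.symm e.symm hg
  exact ⟨{ e with
    continuous_toFun := continuous_of_isCompact_image e h1 h2
    continuous_invFun := continuous_of_isCompact_image e.symm h2 h1 }⟩

end IsSeparatingFamily

/-- A homeomorphism induces an order isomorphism of corresponding families of sets. -/
theorem nonempty_orderIso_of_homeomorph {T : Type v} {T' : Type w} [TopologicalSpace T]
    [TopologicalSpace T'] {B : Set (Set T)} {B' : Set (Set T')} (h : T ≃ₜ T')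
    (hB : ∀ K ∈ B, h '' K ∈ B') (hB' : ∀ K ∈ B', h.symm '' K ∈ B) : Nonempty (B ≃o B') :=
  ⟨{ toFun := fun K => ⟨h '' K, hB K K.2⟩
     invFun := fun K => ⟨h.symm '' K, hB' K K.2⟩
     left_inv := fun K => by ext; simp [image_image]
     right_inv := fun K => by ext; simp [image_image]
     map_rel_iff' := fun {K L} => image_subset_image_iff h.injective }⟩

theorem nonempty_orderIso_of_range_eq {α : Type v} {β : Type w} [PartialOrder α] [PartialOrder β]
    (f : α → β) (hf : ∀ a b, f a ≤ f b ↔ a ≤ b) {S : Set β} (h : range f = S) :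
    Nonempty (S ≃o α) := by
  subst h
  exact ⟨(OrderEmbedding.ofMapLEIff f hf).orderIso.symm⟩

/-! ### Extension to `βX`, vanishing ideals, and closures in `βX` -/

variable {X : Type u} [TopologicalSpace X]

theorem exists_stoneCech_extension (g : X →ᵇ ℝ) :
    ∃ F : C(StoneCech X, ℝ), ∀ x, F (stoneCechUnit x) = g x := by
  have h : Continuous fun x => (⟨g x, abs_le.1 (g.norm_coe_le_norm x)⟩ : Icc (-‖g‖) ‖g‖) :=
    g.continuous.subtype_mk _
  exact ⟨⟨fun z => ((stoneCechExtend h z : Icc (-‖g‖) ‖g‖) : ℝ),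
    continuous_subtype_val.comp (continuous_stoneCechExtend h)⟩, fun x => by simp⟩

/-- The continuous extension of a bounded continuous function to the Stone-Čech compactification. -/
noncomputable def betaExt (g : X →ᵇ ℝ) : C(StoneCech X, ℝ) :=
  (exists_stoneCech_extension g).choose

@[simp]
theorem betaExt_unit (g : X →ᵇ ℝ) (x : X) : betaExt g (stoneCechUnit x) = g x :=
  (exists_stoneCech_extension g).choose_spec x

theorem betaExt_eq {g : X →ᵇ ℝ} {F : C(StoneCech X, ℝ)} (h : ∀ x, F (stoneCechUnit x) = g x) :
    betaExt g = F :=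
  DFunLike.coe_injective <| stoneCech_hom_ext (betaExt g).continuous F.continuous <| by
    ext x; simp [h]

/-- The ideal of all bounded continuous functions whose extension to `βX` vanishes on `Z`. -/
noncomputable def vanishIdeal (Z : Set (StoneCech X)) : Ideal (X →ᵇ ℝ) where
  carrier := {g | ∀ z ∈ Z, betaExt g z = 0}
  zero_mem' := fun z _ => by
    rw [betaExt_eq (F := 0) (fun x => by simp)]; rfl
  add_mem' := fun {f g} hf hg z hz => by
    rw [betaExt_eq (F := betaExt f + betaExt g) (fun x => by simp)]
    simp [hf z hz, hg z hz]
  smul_mem' := fun f g hg z hz => by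
    rw [betaExt_eq (F := betaExt f * betaExt g) (fun x => by simp)]
    simp [hg z hz]

theorem vanishIdeal_le_iff {K L : Set (StoneCech X)} (hK : IsClosed K) :
    vanishIdeal K ≤ vanishIdeal L ↔ L ⊆ K := by
  refine ⟨fun h z hz => by_contra fun hzK => ?_, fun h g hg z hz => hg z (h hz)⟩
  obtain ⟨f, hf0, hf1, -⟩ := exists_continuous_zero_one_of_isClosed hK isClosed_singleton
    (disjoint_singleton_right.2 hzK)
  let g : X →ᵇ ℝ := (BoundedContinuousFunction.mkOfCompact f).compContinuous
    ⟨stoneCechUnit, continuous_stoneCechUnit⟩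
  have hg : betaExt g = f := betaExt_eq fun x => rfl
  have h1 : g ∈ vanishIdeal K := fun w hw => by rw [hg]; exact hf0 hw
  have h2 := h h1 z hz
  rw [hg, hf1 rfl] at h2
  exact one_ne_zero h2

/-- The closure in `βX` of a subset of `X`. -/
def betaClosure (A : Set X) : Set (StoneCech X) := closure (stoneCechUnit '' A)

/-- The part of the closure in `βX` of a subset of `X` that lies outside `X`. -/
def outerPart (A : Set X) : Set (StoneCech X) :=
  betaClosure A \ range (stoneCechUnit : X → StoneCech X)

theorem isClosed_betaClosure (A : Set X) : IsClosed (betaClosure A) := isClosed_closure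

theorem betaClosure_mono {A B : Set X} (h : A ⊆ B) : betaClosure A ⊆ betaClosure B :=
  closure_mono (image_mono h)

theorem betaClosure_union (A B : Set X) :
    betaClosure (A ∪ B) = betaClosure A ∪ betaClosure B := by
  simp [betaClosure, image_union]

theorem betaClosure_univ : betaClosure (univ : Set X) = univ := by
  rw [betaClosure, image_univ]; exact denseRange_stoneCechUnit.closure_range

theorem betaClosure_closure (A : Set X) : betaClosure (closure A) = betaClosure A :=
  Subset.antisymm (closure_minimal ((image_closure_subset_closure_image
    continuous_stoneCechUnit)) isClosed_closure) (betaClosure_mono subset_closure)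

theorem betaClosure_subset_preimage {F : Set (StoneCech X)} (hF : IsClosed F) {A : Set X}
    (h : ∀ x ∈ A, stoneCechUnit x ∈ F) : betaClosure A ⊆ F :=
  closure_minimal (image_subset_iff.2 h) hF

theorem subset_betaClosure_preimage {W : Set (StoneCech X)} (hW : IsOpen W) :
    W ⊆ betaClosure (stoneCechUnit ⁻¹' W) := by
  rw [betaClosure, image_preimage_eq_inter_range]
  exact denseRange_stoneCechUnit.open_subset_closure_inter hW

theorem compl_betaClosure_compl_subset (A : Set X) : (betaClosure Aᶜ)ᶜ ⊆ betaClosure A := by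
  intro z hz
  have : z ∈ betaClosure (A ∪ Aᶜ) := by rw [union_compl_self, betaClosure_univ]; trivial
  rw [betaClosure_union] at this
  exact this.resolve_right hz

theorem betaClosure_of_isCompact {A : Set X} (hA : IsCompact A) :
    betaClosure A = stoneCechUnit '' A :=
  (hA.image continuous_stoneCechUnit).isClosed.closure_eq

section T35

variable [T35Space X]

theorem unit_mem_betaClosure {A : Set X} (hA : IsClosed A) {x : X} :
    stoneCechUnit x ∈ betaClosure A ↔ x ∈ A := by
  have h := isEmbedding_stoneCechUnit (X := X) |>.isInducing.closure_eq_preimage_closure_image A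
  rw [hA.closure_eq] at h
  exact (Set.ext_iff.1 h x).symm

/-- The trace on `X` of the closure of a closed `A` is `A` itself, so a closure that stays inside
`X` is just the image of `A`. -/
theorem isCompact_of_betaClosure_subset {A : Set X} (hA : IsClosed A)
    (h : betaClosure A ⊆ range stoneCechUnit) : IsCompact A := by
  have h1 : betaClosure A = stoneCechUnit '' A := by
    refine Subset.antisymm (fun z hz => ?_) subset_closure
    obtain ⟨x, rfl⟩ := h hz
    exact mem_image_of_mem _ ((unit_mem_betaClosure hA).1 hz)
  rw [isEmbedding_stoneCechUnit.isCompact_iff, ← h1]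
  exact (isClosed_betaClosure A).isCompact

theorem isCompact_level_inter {g : X →ᵇ ℝ} {A : Set X} (hA : IsClosed A) {ε : ℝ}
    (h : ∀ z ∈ outerPart A, |betaExt g z| < ε) : IsCompact ({x | ε ≤ |g x|} ∩ A) := by
  refine isCompact_of_betaClosure_subset ((isClosed_level g ε).inter hA) fun z hz => ?_
  by_contra hzX
  have h1 := h z ⟨betaClosure_mono inter_subset_right hz, hzX⟩
  have h2 : z ∈ {z | ε ≤ |betaExt g z|} := betaClosure_subset_preimage
    (isClosed_le continuous_const (continuous_abs.comp (betaExt g).continuous))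
    (fun x hx => by simpa using hx.1) hz
  exact absurd h1 (not_lt.2 h2)

theorem outerPart_nonempty {A : Set X} (hA : ¬ IsCompact (closure A)) : (outerPart A).Nonempty := by
  by_contra h
  rw [not_nonempty_iff_eq_empty, outerPart, sdiff_eq_empty] at h
  exact hA (isCompact_of_betaClosure_subset isClosed_closure (by rwa [betaClosure_closure]))

end T35

/-- The compact part of `A` contributes no closure points outside `X`, and on the rest of `A` the
bound already holds. With `isCompact_level_inter` this translates compactness of level sets into the
size of the extension on the outer part. -/
theorem abs_betaExt_le {g : X →ᵇ ℝ} {A : Set X} {ε : ℝ}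
    (h : IsCompact ({x | ε ≤ |g x|} ∩ A)) {z : StoneCech X} (hz : z ∈ outerPart A) :
    |betaExt g z| ≤ ε := by
  have h1 : A ⊆ ({x | ε ≤ |g x|} ∩ A) ∪ {x | |g x| ≤ ε} := fun x hx =>
    (le_total ε |g x|).imp (fun h => ⟨h, hx⟩) id
  have h2 := betaClosure_mono h1 hz.1
  rw [betaClosure_union, betaClosure_of_isCompact h] at h2
  rcases h2 with ⟨x, -, rfl⟩ | h2
  · exact absurd (mem_range_self x) hz.2
  · exact betaClosure_subset_preimage (F := {z | |betaExt g z| ≤ ε})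
      (isClosed_le (continuous_abs.comp (betaExt g).continuous) continuous_const)
      (fun x hx => by simpa using hx) h2

/-! ### The ideals as vanishing ideals -/

section Normal

variable [T4Space X]

theorem openIdeal_eq_vanishIdeal (E : Opens X) :
    openIdeal E = vanishIdeal (outerPart ((E : Set X)ᶜ)) := by
  ext g
  refine ⟨fun hg z hz => ?_, fun hg ε hε => ?_⟩
  · refine abs_nonpos_iff.1 (le_of_forall_pos_le_add fun ε hε => ?_)
    rw [zero_add]
    exact abs_betaExt_le (hg ε hε) hz
  · rw [sdiff_eq]
    exact isCompact_level_inter E.isOpen.isClosed_compl fun z hz => by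
      simpa [hg z hz] using hε

theorem disjoint_betaClosure {A B : Set X} (hA : IsClosed A) (hB : IsClosed B)
    (h : Disjoint A B) : Disjoint (betaClosure A) (betaClosure B) := by
  obtain ⟨f, hf0, hf1, hf⟩ := exists_bounded_zero_one_of_closed hA hB h
  refine disjoint_left.2 fun z hzA hzB => ?_
  have h0 : betaExt f z = 0 := betaClosure_subset_preimage (F := {z | betaExt f z = 0})
    (isClosed_eq (betaExt f).continuous continuous_const) (fun x hx => by simpa using hf0 hx) hzA
  have h1 : betaExt f z = 1 := betaClosure_subset_preimage (F := {z | betaExt f z = 1})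
    (isClosed_eq (betaExt f).continuous continuous_const) (fun x hx => by simpa using hf1 hx) hzB
  exact zero_ne_one (h0.symm.trans h1)

theorem betaClosure_compl {U : Set X} (hU : IsClopen U) : betaClosure Uᶜ = (betaClosure U)ᶜ := by
  refine Subset.antisymm ?_ fun z hz => ?_
  · exact (disjoint_betaClosure hU.compl.1 hU.1 disjoint_compl_left).subset_compl_right
  · by_contra h
    exact hz (compl_betaClosure_compl_subset U h)

theorem isClopen_betaClosure {U : Set X} (hU : IsClopen U) : IsClopen (betaClosure U) :=
  ⟨isClosed_betaClosure U, by
    rw [← isClosed_compl_iff, ← betaClosure_compl hU]; exact isClosed_betaClosure _⟩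

variable [LocallyCompactSpace X]

theorem isOpen_range_unit : IsOpen (range (stoneCechUnit : X → StoneCech X)) := by
  rw [isOpen_iff_mem_nhds]
  rintro _ ⟨x, rfl⟩
  obtain ⟨N, hN, hxN⟩ := exists_compact_mem_nhds x
  have h1 : stoneCechUnit x ∈ (betaClosure (interior N)ᶜ)ᶜ := by
    rw [mem_compl_iff, unit_mem_betaClosure isOpen_interior.isClosed_compl, notMem_compl_iff]
    exact mem_interior_iff_mem_nhds.2 hxN
  refine Filter.mem_of_superset ((isClosed_betaClosure _).isOpen_compl.mem_nhds h1) ?_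
  refine (compl_betaClosure_compl_subset _).trans ((betaClosure_mono interior_subset).trans ?_)
  rw [betaClosure_of_isCompact hN]
  exact image_subset_range _ _

theorem isClosed_outerPart (A : Set X) : IsClosed (outerPart A) :=
  (isClosed_betaClosure A).sdiff isOpen_range_unit

theorem seqIdeal_eq_vanishIdeal {U : ℕ → Set X} (hU : IsSigmaRegular U) :
    seqIdeal U hU = vanishIdeal (⋂ n, outerPart (U n)) := by
  ext g
  have hc : ∀ n, outerPart (closure (U n)) = outerPart (U n) := fun n => by
    rw [outerPart, betaClosure_closure, outerPart]
  refine ⟨fun hg z hz => ?_, fun hg ε hε => ?_⟩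
  · refine abs_nonpos_iff.1 (le_of_forall_pos_le_add fun ε hε => ?_)
    rw [zero_add]
    obtain ⟨n, hn⟩ := hg ε hε
    exact abs_betaExt_le hn (hc n ▸ mem_iInter.1 hz n)
  -- These closed sets decrease, and their intersection is empty because the extension vanishes on
  -- all of `⋂ n, outerPart (U n)`; compactness makes one of them empty.
  · have h2 : ∃ n, ¬ (outerPart (U n) ∩ {z | ε ≤ |betaExt g z|}).Nonempty := by
      by_contra! h
      have hcl : ∀ n, IsClosed (outerPart (U n) ∩ {z | ε ≤ |betaExt g z|}) := fun n =>
        (isClosed_outerPart _).inter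
          (isClosed_le continuous_const (continuous_abs.comp (betaExt g).continuous))
      obtain ⟨z, hz⟩ := IsCompact.nonempty_iInter_of_sequence_nonempty_isCompact_isClosed
        (fun n => outerPart (U n) ∩ {z | ε ≤ |betaExt g z|})
        (fun n => inter_subset_inter_left _ (sdiff_subset_sdiff_left (betaClosure_mono
          (subset_closure.trans (hU.closure_succ_subset n))))) h (hcl 0).isCompact hcl
      have h0 := hg z (mem_iInter.2 fun n => (mem_iInter.1 hz n).1)
      have h1 : ε ≤ |betaExt g z| := (mem_iInter.1 hz 0).2
      rw [h0, abs_zero] at h1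
      exact absurd hε (not_lt.2 h1)
    obtain ⟨n, hn⟩ := h2
    refine ⟨n, isCompact_level_inter isClosed_closure fun z hz => ?_⟩
    rw [hc] at hz
    by_contra! h
    exact hn ⟨z, hz, h⟩

end Normal

/-! ### Clopen σ-compact sets and local compactness of the remainder -/

theorem countable_inter_nonempty_of_isSigmaCompact {v : X → Set X} (hv : LocallyFinite v)
    {A : Set X} (hA : IsSigmaCompact A) : {i | (v i ∩ A).Nonempty}.Countable := by
  obtain ⟨K, hK, rfl⟩ := hA
  have : {i | (v i ∩ ⋃ n, K n).Nonempty} = ⋃ n, {i | (v i ∩ K n).Nonempty} := by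
    ext i; simp [inter_iUnion]
  rw [this]
  exact countable_iUnion fun n => (hv.finite_nonempty_inter_compact (hK n)).countable

theorem betaClosure_subset_sigmaPart {A : Set X} (hA : IsSigmaCompact A) :
    betaClosure A ⊆ sigmaPart X :=
  subset_biUnion_of_mem (u := fun A : Set X => closure (stoneCechUnit '' A)) hA

theorem outerPart_subset_sigmaRemainder {A : Set X} (hA : IsSigmaCompact A) :
    outerPart A ⊆ sigmaRemainder X :=
  sdiff_subset_sdiff_left (betaClosure_subset_sigmaPart hA)

section Paracompact

variable [T2Space X] [LocallyCompactSpace X] [ParacompactSpace X]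

variable (X) in
theorem exists_locallyFinite_isCompact_closure :
    ∃ v : X → Set X, (∀ i, IsOpen (v i)) ∧ (⋃ i, v i = univ) ∧ LocallyFinite v ∧
      ∀ i, IsCompact (closure (v i)) := by
  choose N hN hxN using fun x : X => exists_compact_mem_nhds x
  obtain ⟨v, hvo, hvc, hvl, hvN⟩ := precise_refinement (fun x => interior (N x))
    (fun x => isOpen_interior)
    (eq_univ_of_forall fun x => mem_iUnion.2 ⟨x, mem_interior_iff_mem_nhds.2 (hxN x)⟩)
  exact ⟨v, hvo, hvc, hvl, fun i => (hN i).of_isClosed_subset isClosed_closure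
    (closure_minimal ((hvN i).trans interior_subset) (hN i).isClosed)⟩

/-- Start from the indices of cover members meeting `A` and repeatedly add those meeting the
closures already chosen. Local finiteness keeps the index set countable, and saturation makes the
union closed: a cover member that meets it belongs to it. -/
theorem exists_clopen_isSigmaCompact_superset {A : Set X} (hA : IsSigmaCompact A) :
    ∃ M : Set X, IsClopen M ∧ IsSigmaCompact M ∧ A ⊆ M := by
  obtain ⟨v, hvo, hvc, hvl, hvk⟩ := exists_locallyFinite_isCompact_closure X
  let J : ℕ → Set X := fun n => Nat.rec {i | (v i ∩ A).Nonempty}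
    (fun _ S => {i | (v i ∩ ⋃ j ∈ S, closure (v j)).Nonempty}) n
  have hsc : ∀ S : Set X, S.Countable → IsSigmaCompact (⋃ j ∈ S, closure (v j)) := fun S hS =>
    isSigmaCompact_biUnion hS fun j _ => (hvk j).isSigmaCompact
  have hJ : ∀ n, (J n).Countable := by
    intro n
    induction n with
    | zero => exact countable_inter_nonempty_of_isSigmaCompact hvl hA
    | succ n ih => exact countable_inter_nonempty_of_isSigmaCompact hvl (hsc _ ih)
  have hJs : ∀ n i j, j ∈ J n → (v i ∩ closure (v j)).Nonempty → i ∈ J (n + 1) :=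
    fun n i j hj h => h.mono (inter_subset_inter_right _
      (subset_biUnion_of_mem (u := fun j => closure (v j)) hj))
  let M := ⋃ j ∈ ⋃ n, J n, v j
  have hMo : IsOpen M := isOpen_biUnion fun j _ => hvo j
  have hMc : IsClosed M := by
    rw [← isOpen_compl_iff, isOpen_iff_mem_nhds]
    intro x hx
    obtain ⟨i, hi⟩ := mem_iUnion.1 (hvc.symm ▸ mem_univ x : x ∈ ⋃ i, v i)
    refine Filter.mem_of_superset ((hvo i).mem_nhds hi) fun y hy hyM => hx ?_
    obtain ⟨j, hj, hyj⟩ := mem_iUnion₂.1 hyM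
    obtain ⟨n, hn⟩ := mem_iUnion.1 hj
    exact mem_iUnion₂.2 ⟨i, mem_iUnion.2 ⟨n + 1, hJs n i j hn ⟨y, hy, subset_closure hyj⟩⟩, hi⟩
  refine ⟨M, ⟨hMc, hMo⟩, (hsc _ (countable_iUnion hJ)).of_isClosed_subset hMc
    (iUnion₂_mono fun j _ => subset_closure), fun x hx => ?_⟩
  obtain ⟨i, hi⟩ := mem_iUnion.1 (hvc.symm ▸ mem_univ x : x ∈ ⋃ i, v i)
  exact mem_iUnion₂.2 ⟨i, mem_iUnion.2 ⟨0, ⟨x, hi, hx⟩⟩, hi⟩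

theorem exists_clopen_of_mem_sigmaPart {z : StoneCech X} (hz : z ∈ sigmaPart X) :
    ∃ M : Set X, IsClopen M ∧ IsSigmaCompact M ∧ z ∈ betaClosure M := by
  obtain ⟨A, hA, hzA⟩ := mem_iUnion₂.1 hz
  obtain ⟨M, hM, hMs, hAM⟩ := exists_clopen_isSigmaCompact_superset hA
  exact ⟨M, hM, hMs, betaClosure_mono hAM hzA⟩

variable (X) in
theorem isOpen_sigmaPart : IsOpen (sigmaPart X) := by
  rw [isOpen_iff_mem_nhds]
  intro z hz
  obtain ⟨M, hM, hMs, hzM⟩ := exists_clopen_of_mem_sigmaPart hz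
  exact Filter.mem_of_superset ((isClopen_betaClosure hM).2.mem_nhds hzM)
    (betaClosure_subset_sigmaPart hMs)

theorem exists_clopen_of_isCompact_subset {K : Set (StoneCech X)} (hK : IsCompact K)
    (h : K ⊆ sigmaPart X) :
    ∃ M : Set X, IsClopen M ∧ IsSigmaCompact M ∧ K ⊆ betaClosure M := by
  let ι := {M : Set X // IsClopen M ∧ IsSigmaCompact M}
  have : Nonempty ι := ⟨⟨∅, isClopen_empty, isSigmaCompact_empty⟩⟩
  obtain ⟨M, hM⟩ := hK.elim_directed_cover (fun M : ι => betaClosure M.1)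
    (fun M => (isClopen_betaClosure M.2.1).2)
    (fun z hz => by
      obtain ⟨M, hM, hMs, hzM⟩ := exists_clopen_of_mem_sigmaPart (h hz)
      exact mem_iUnion.2 ⟨⟨M, hM, hMs⟩, hzM⟩)
    (fun M N => ⟨⟨M.1 ∪ N.1, M.2.1.union N.2.1, by
      rw [← sUnion_pair]
      refine isSigmaCompact_sUnion _ ((Set.toFinite {M.1, N.1}).countable) fun s => ?_
      rcases s.2 with h | h
      · rw [h]; exact M.2.2
      · rw [mem_singleton_iff.1 h]; exact N.2.2⟩,
      betaClosure_mono subset_union_left, betaClosure_mono subset_union_right⟩)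
  exact ⟨M.1, M.2.1, M.2.2, hM⟩

instance : LocallyCompactSpace (sigmaRemainder X) :=
  ((isOpen_sigmaPart X).isLocallyClosed.inter
    isOpen_range_unit.isClosed_compl.isLocallyClosed).locallyCompactSpace

end Paracompact

/-! ### Separation by compact Gδ sets and by clopen sets -/

/-- The nonempty compact `Gδ` subsets of a space. -/
def compactGdeltas (T : Type u) [TopologicalSpace T] : Set (Set T) :=
  {K | IsCompact K ∧ K.Nonempty ∧ IsGδ K}

/-- The nonempty compact open subsets of a space. -/
def nonemptyCompactOpens (T : Type u) [TopologicalSpace T] : Set (Set T) :=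
  {K | IsCompact K ∧ K.Nonempty ∧ IsOpen K}

/-- The compact open subsets of a space. -/
def compactOpenSets (T : Type u) [TopologicalSpace T] : Set (Set T) :=
  {K | IsCompact K ∧ IsOpen K}

theorem isSeparatingFamily_compactGdeltas (T : Type u) [TopologicalSpace T] [T2Space T]
    [LocallyCompactSpace T] : IsSeparatingFamily (compactGdeltas T) where
  isCompact _ h := h.1
  nonempty _ h := h.2.1
  inter_mem _ hK _ hL h := ⟨hK.1.inter hL.1, h, hK.2.2.inter hL.2.2⟩
  exists_superset C D hC hne hD hd := by
    -- Compact support makes the level set `f ⁻¹' {1}` compact, and every such level set is a Gδ.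
    obtain ⟨f, hf1, hf0, hfc, -⟩ := exists_continuous_one_zero_of_isCompact hC hD.isClosed hd
    have hcl : IsClosed (f ⁻¹' {1}) := isClosed_singleton.preimage f.continuous
    refine ⟨f ⁻¹' {1}, ⟨?_, hne.mono hf1, ?_⟩, hf1, ?_⟩
    · refine hfc.of_isClosed_subset hcl fun x hx => subset_tsupport f ?_
      simp only [mem_preimage, mem_singleton_iff] at hx
      simp [hx]
    · exact (isClosed_singleton (x := (1 : ℝ))).isGδ.preimage f.continuous
    · refine disjoint_left.2 fun x hx hxD => ?_
      have := hf0 hxD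
      simp only [mem_preimage, mem_singleton_iff, Pi.zero_apply] at hx this
      exact zero_ne_one (this.symm.trans hx)

/-- `M` is Lindelöf, so countably many clopen sets, each missing `A` or `B`, cover it. Made
disjoint, they partition `M`, and `W` collects the pieces that miss `B`. -/
theorem exists_clopen_separating {M : Set X} (hX : IsZeroDimensional X)
    (hM : IsClopen M) (hMs : IsSigmaCompact M) {A B : Set X} (hA : IsClosed A) (hB : IsClosed B)
    (hd : Disjoint A B) : ∃ W ⊆ M, IsClopen W ∧ A ∩ M ⊆ W ∧ Disjoint W B := by
  have hC : ∀ x : X, ∃ C : Set X, IsClopen C ∧ x ∈ C ∧ (Disjoint C A ∨ Disjoint C B) := by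
    intro x
    by_cases hx : x ∈ A
    · obtain ⟨C, hC, hxC, hCB⟩ := hX.exists_subset_of_mem_open
        (show x ∈ Bᶜ from disjoint_left.1 hd hx) hB.isOpen_compl
      exact ⟨C, hC, hxC, Or.inr (subset_compl_iff_disjoint_right.1 hCB)⟩
    · obtain ⟨C, hC, hxC, hCA⟩ := hX.exists_subset_of_mem_open
        (show x ∈ Aᶜ from hx) hA.isOpen_compl
      exact ⟨C, hC, hxC, Or.inl (subset_compl_iff_disjoint_right.1 hCA)⟩
  choose C hCc hxC hCd using hC
  have hMl : IsLindelof M := by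
    obtain ⟨K, hK, rfl⟩ := hMs
    exact isLindelof_iUnion fun n => (hK n).isLindelof
  obtain ⟨t, htc, ht⟩ := hMl.elim_countable_subcover C (fun x => (hCc x).2)
    fun x _ => mem_iUnion.2 ⟨x, hxC x⟩
  obtain ⟨c, hc, hcd, hMc⟩ : ∃ c : ℕ → Set X, (∀ n, IsClopen (c n)) ∧
      (∀ n, Disjoint (c n) A ∨ Disjoint (c n) B) ∧ M ⊆ ⋃ n, c n := by
    rcases t.eq_empty_or_nonempty with rfl | hne
    · exact ⟨fun _ => ∅, fun _ => isClopen_empty, fun _ => Or.inl (empty_disjoint _), by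
        simpa using ht⟩
    · obtain ⟨s, rfl⟩ := htc.exists_eq_range hne
      exact ⟨fun n => C (s n), fun n => hCc _, fun n => hCd _, by simpa using ht⟩
  have hdo : ∀ n, IsOpen (disjointed c n) := fun n =>
    disjointedRec (p := IsOpen) (fun _ _ h => h.sdiff (hc _).1) (hc n).2
  have hdd : Pairwise (Function.onFun Disjoint (disjointed c)) := disjoint_disjointed c
  let S := {n | Disjoint (disjointed c n) B}
  have hMd : ∀ x ∈ M, ∃ n, x ∈ disjointed c n := fun x hx =>
    mem_iUnion.1 ((iUnion_disjointed (f := c)).symm ▸ hMc hx)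
  refine ⟨M ∩ ⋃ n ∈ S, disjointed c n, inter_subset_left, ⟨?_, ?_⟩, ?_, ?_⟩
  -- Inside `M` the complement of `W` is the union of the remaining open pieces, so `W` is closed.
  · have : M ∩ ⋃ n ∈ S, disjointed c n = M \ ⋃ n ∈ Sᶜ, disjointed c n := by
      ext x
      simp only [mem_inter_iff, mem_sdiff, mem_iUnion₂, not_exists]
      refine and_congr_right fun hx => ⟨?_, fun h => ?_⟩
      · rintro ⟨n, hn, hxn⟩ m hm hxm
        rcases eq_or_ne n m with rfl | hnm
        · exact hm hn
        · exact disjoint_left.1 (hdd hnm) hxn hxm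
      · obtain ⟨n, hn⟩ := hMd x hx
        exact ⟨n, by_contra fun hnS => h n hnS hn, hn⟩
    rw [this]
    exact hM.1.sdiff (isOpen_biUnion fun n _ => hdo n)
  · exact hM.2.inter (isOpen_biUnion fun n _ => hdo n)
  · rintro x ⟨hxA, hxM⟩
    obtain ⟨n, hn⟩ := hMd x hxM
    refine ⟨hxM, mem_iUnion₂.2 ⟨n, ?_, hn⟩⟩
    refine ((hcd n).resolve_left fun h => ?_).mono_left (disjointed_subset c n)
    exact disjoint_left.1 h (disjointed_subset c n hn) hxA
  · refine disjoint_left.2 ?_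
    rintro x ⟨-, hx⟩ hxB
    obtain ⟨n, hn, hxn⟩ := mem_iUnion₂.1 hx
    exact disjoint_left.1 hn hxn hxB

theorem exists_clopen_separating_stoneCech [T4Space X] {M : Set X} (hX : IsZeroDimensional X)
    (hM : IsClopen M) (hMs : IsSigmaCompact M) {C D : Set (StoneCech X)} (hC : IsClosed C)
    (hD : IsClosed D) (hCM : C ⊆ betaClosure M)  (hd : Disjoint C D) :
    ∃ W ⊆ M, IsClopen W ∧ C ⊆ betaClosure W ∧ Disjoint (betaClosure W) D := by
  obtain ⟨f, hf0, hf1, -⟩ := exists_continuous_zero_one_of_isClosed hC hD hd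
  have hcont := f.continuous.comp (continuous_stoneCechUnit (α := X))
  -- The thresholds leave room for closures: `C` lies in the open set `f < 1/3`, whose trace on `M`
  -- is inside `W`, while `f ≤ 2/3` persists on the closure of `W` and excludes `D`.
  obtain ⟨W, hWM, hW, hAW, hWB⟩ := exists_clopen_separating hX hM hMs
    (isClosed_le hcont (continuous_const (y := (1 / 3 : ℝ))))
    (isClosed_le (continuous_const (y := (2 / 3 : ℝ))) hcont)
    (disjoint_left.2 fun x (h1 : f (stoneCechUnit x) ≤ 1 / 3)
      (h2 : 2 / 3 ≤ f (stoneCechUnit x)) => by linarith)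
  refine ⟨W, hWM, hW, ?_, ?_⟩
  · have h1 : C ⊆ f ⁻¹' Iio (1 / 3) ∩ betaClosure M :=
      subset_inter (fun z hz => by simp [hf0 hz]) hCM
    refine h1.trans ((subset_betaClosure_preimage ((isOpen_Iio.preimage f.continuous).inter
      (isClopen_betaClosure hM).2)).trans ?_)
    exact betaClosure_mono fun x hx => hAW ⟨(show f (stoneCechUnit x) < 1 / 3 from hx.1).le,
      (unit_mem_betaClosure hM.1).1 hx.2⟩
  · refine disjoint_left.2 fun z hz hzD => ?_
    have h1 : z ∈ {z | f z ≤ 2 / 3} := betaClosure_subset_preimage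
      (isClosed_le f.continuous continuous_const)
      (fun x hx => (le_total (f (stoneCechUnit x)) (2 / 3)).resolve_right
        fun h => disjoint_left.1 hWB hx h) hz
    have h2 := hf1 hzD
    simp only [Pi.one_apply] at h2
    rw [mem_ofPred_eq, h2] at h1
    norm_num at h1

theorem image_preimage_outerPart {A : Set X} (hA : IsSigmaCompact A) :
    ((↑) : sigmaRemainder X → StoneCech X) '' ((↑) ⁻¹' betaClosure A) = outerPart A := by
  rw [Subtype.image_preimage_coe]
  refine Subset.antisymm (fun z hz => ⟨hz.2, hz.1.2⟩)
    fun z hz => ⟨outerPart_subset_sigmaRemainder hA hz, hz.1⟩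

/-! ### `Ω_X` and the compact Gδ subsets of the remainder -/

theorem mem_image_or_not_mem_range {K : Set (sigmaRemainder X)} {z : StoneCech X}
    (hz : z ∈ ((↑) : sigmaRemainder X → StoneCech X) '' K) : z ∉ range stoneCechUnit := by
  obtain ⟨y, -, rfl⟩ := hz
  exact y.2.2

theorem vanishIdeal_image_le_iff {K L : Set (sigmaRemainder X)} (hK : IsCompact K) :
    vanishIdeal (Subtype.val '' K) ≤ vanishIdeal (Subtype.val '' L) ↔ L ⊆ K := by
  rw [vanishIdeal_le_iff (hK.image continuous_subtype_val).isClosed,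
    image_subset_image_iff Subtype.val_injective]

section LocallyCompact

variable [T4Space X] [LocallyCompactSpace X]

theorem IsSigmaRegular.exists_compactGdelta {U : ℕ → Set X} (hU : IsSigmaRegular U) :
    ∃ K ∈ compactGdeltas (sigmaRemainder X),
      ((↑) : sigmaRemainder X → StoneCech X) '' K = ⋂ n, outerPart (U n) := by
  let K : Set (sigmaRemainder X) := (↑) ⁻¹' ⋂ n, outerPart (U n)
  have hK : ((↑) : sigmaRemainder X → StoneCech X) '' K = ⋂ n, outerPart (U n) := by
    rw [Subtype.image_preimage_coe, inter_eq_right]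
    refine (iInter_subset _ 0).trans (Subset.trans ?_
      (outerPart_subset_sigmaRemainder (hU.isSigmaCompact_closure 0)))
    exact sdiff_subset_sdiff_left (betaClosure_mono subset_closure)
  have hne : (⋂ n, outerPart (U n)).Nonempty :=
    IsCompact.nonempty_iInter_of_sequence_nonempty_isCompact_isClosed _
      (fun n => sdiff_subset_sdiff_left (betaClosure_mono
        (subset_closure.trans (hU.closure_succ_subset n))))
      (fun n => outerPart_nonempty (hU.not_isCompact_closure n))
      (isClosed_outerPart _).isCompact (fun n => isClosed_outerPart _)
  refine ⟨K, ⟨?_, ?_, ?_⟩, hK⟩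
  · rw [Subtype.isCompact_iff, hK]
    exact (isClosed_iInter fun n => isClosed_outerPart _).isCompact
  · rw [← image_nonempty (f := ((↑) : sigmaRemainder X → StoneCech X)), hK]
    exact hne
  -- The sets `outerPart (U n)` are closed, so open sets are interleaved with them: the closure of
  -- `U (n + 1)` in `βX` misses that of the complement of `U n`.
  · have h : K = ⋂ n, (↑) ⁻¹' (betaClosure (U n)ᶜ)ᶜ := by
      ext z
      simp only [K, mem_preimage, mem_iInter, mem_compl_iff]
      refine ⟨fun h n hn => ?_, fun h n => ⟨compl_betaClosure_compl_subset _ (h n), z.2.2⟩⟩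
      have h1 := betaClosure_mono subset_closure (h (n + 1)).1
      exact disjoint_left.1 (disjoint_betaClosure isClosed_closure (hU.isOpen n).isClosed_compl
        (disjoint_compl_right_iff_subset.2 (hU.closure_succ_subset n))) h1 hn
    rw [h]
    exact IsGδ.iInter fun n =>
      ((isClosed_betaClosure _).isOpen_compl.preimage continuous_subtype_val).isGδ

end LocallyCompact

section Paracompact

variable [T2Space X] [LocallyCompactSpace X] [ParacompactSpace X]

/-- By normality of `βX`, neighbourhoods of `K` shrink along the open sets that witness the Gδ
property; their traces on `X` form the sequence. -/
theorem exists_isSigmaRegular {K : Set (sigmaRemainder X)}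
    (hK : K ∈ compactGdeltas (sigmaRemainder X)) :
    ∃ U : ℕ → Set X, IsSigmaRegular U ∧
      ((↑) : sigmaRemainder X → StoneCech X) '' K = ⋂ n, outerPart (U n) := by
  obtain ⟨hKc, hne, hG⟩ := hK
  set K' := ((↑) : sigmaRemainder X → StoneCech X) '' K with hK'
  have hK'c : IsCompact K' := hKc.image continuous_subtype_val
  have hK'X : ∀ z ∈ K', z ∉ range stoneCechUnit := fun z hz => mem_image_or_not_mem_range hz
  obtain ⟨V, hVo, hV⟩ := hG.eq_iInter_nat
  choose O hO hOV using fun n => isOpen_induced_iff.1 (hVo n)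
  have hKO : ∀ n, K' ⊆ O n := by
    rintro n _ ⟨y, hy, rfl⟩
    rw [hV] at hy
    have := mem_iInter.1 hy n
    rwa [← hOV n] at this
  obtain ⟨M, hM, hMs, hKM⟩ := exists_clopen_of_isCompact_subset hK'c (by
    rintro _ ⟨y, -, rfl⟩; exact y.2.1)
  let S := {W : Set (StoneCech X) // IsOpen W ∧ K' ⊆ W}
  have step : ∀ (n : ℕ) (W : S), ∃ W' : S, closure W'.1 ⊆ W.1 ∩ O n := fun n W => by
    obtain ⟨W', h1, h2, h3⟩ := normal_exists_closure_subset hK'c.isClosed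
      (W.2.1.inter (hO n)) (subset_inter W.2.2 (hKO n))
    exact ⟨⟨W', h1, h2⟩, h3⟩
  choose next hnext using step
  -- Starting at `betaClosure M` keeps every trace inside the σ-compact set `M`.
  let W : ℕ → S := fun n => Nat.rec ⟨betaClosure M, (isClopen_betaClosure hM).2, hKM⟩ next n
  have hW : ∀ n, closure (W (n + 1)).1 ⊆ (W n).1 ∩ O n := fun n => hnext n (W n)
  have hanti : Antitone fun n => (W n).1 :=
    antitone_nat_of_succ_le fun n => subset_closure.trans ((hW n).trans inter_subset_left)
  have hsub : ∀ n, (W n).1 ⊆ betaClosure (stoneCechUnit ⁻¹' (W n).1) :=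
    fun n => subset_betaClosure_preimage (W n).2.1
  have hclU : ∀ n, closure (stoneCechUnit ⁻¹' (W n).1) ⊆ M := fun n =>
    closure_minimal (fun x hx => (unit_mem_betaClosure hM.1).1 (hanti (Nat.zero_le n) hx)) hM.1
  have hUs : ∀ n, IsSigmaCompact (closure (stoneCechUnit ⁻¹' (W n).1)) := fun n =>
    hMs.of_isClosed_subset isClosed_closure (hclU n)
  refine ⟨fun n => stoneCechUnit ⁻¹' (W n).1, ⟨fun n => (W n).2.1.preimage
    continuous_stoneCechUnit, hUs, fun n hc => ?_, fun n => ?_⟩, ?_⟩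
  -- Compact closure of a trace would confine its closure in `βX` to `X`, yet that closure contains
  -- `K'`.
  · obtain ⟨z, hz⟩ := hne.image ((↑) : sigmaRemainder X → StoneCech X)
    have h1 := betaClosure_mono subset_closure (hsub n ((W n).2.2 hz))
    rw [betaClosure_of_isCompact hc] at h1
    exact hK'X z hz (image_subset_range _ _ h1)
  · exact (continuous_stoneCechUnit.closure_preimage_subset _).trans
      (preimage_mono ((hW n).trans inter_subset_left))
  · refine Subset.antisymm (fun z hz => mem_iInter.2 fun n => ⟨hsub n ((W n).2.2 hz), hK'X z hz⟩)
      fun z hz => ?_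
    have hzT : z ∈ sigmaRemainder X := outerPart_subset_sigmaRemainder (hUs 0)
      ⟨betaClosure_mono subset_closure (mem_iInter.1 hz 0).1, (mem_iInter.1 hz 0).2⟩
    refine ⟨⟨z, hzT⟩, ?_, rfl⟩
    rw [hV]
    refine mem_iInter.2 fun n => ?_
    rw [← hOV n]
    exact (hW n (betaClosure_subset_preimage isClosed_closure
      (fun x hx => subset_closure hx) (mem_iInter.1 hz (n + 1)).1)).2

variable (X) in
theorem nonempty_orderIso_omegaIdeals :
    Nonempty (OmegaIdeals X ≃o (compactGdeltas (sigmaRemainder X))ᵒᵈ) := by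
  refine nonempty_orderIso_of_range_eq
    (fun K : (compactGdeltas (sigmaRemainder X))ᵒᵈ =>
      vanishIdeal (Subtype.val '' (OrderDual.ofDual K).1))
    (fun K L => vanishIdeal_image_le_iff (OrderDual.ofDual K).2.1) ?_
  ext I
  constructor
  · rintro ⟨K, rfl⟩
    obtain ⟨U, hU, h⟩ := exists_isSigmaRegular (OrderDual.ofDual K).2
    exact ⟨U, hU, by rw [seqIdeal_eq_vanishIdeal, ← h]⟩
  · rintro ⟨U, hU, rfl⟩
    obtain ⟨K, hK, h⟩ := hU.exists_compactGdelta
    exact ⟨OrderDual.toDual ⟨K, hK⟩, by rw [seqIdeal_eq_vanishIdeal, ← h]; rfl⟩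

/-! ### `Δ_X`, `Σ_X` and the compact open subsets of the remainder -/

theorem exists_compactOpenSet {U : Set X} (hU : IsClopen U) (hUs : IsSigmaCompact U) :
    ∃ K ∈ compactOpenSets (sigmaRemainder X),
      ((↑) : sigmaRemainder X → StoneCech X) '' K = outerPart U := by
  refine ⟨(↑) ⁻¹' betaClosure U, ⟨?_, ?_⟩, image_preimage_outerPart hUs⟩
  · rw [Subtype.isCompact_iff, image_preimage_outerPart hUs]
    exact (isClosed_outerPart U).isCompact
  · exact (isClopen_betaClosure hU).2.preimage continuous_subtype_val

/-- Since `K` is compact and relatively open, `K` and the rest of `outerPart M` are disjoint closed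
sets in `βX`; a clopen `W ⊆ M` separating them has outer part exactly `K`. -/
theorem exists_clopen_outerPart_eq (hX : IsZeroDimensional X) {K : Set (sigmaRemainder X)}
    (hK : K ∈ compactOpenSets (sigmaRemainder X)) :
    ∃ U : Clopens X, IsSigmaCompact (U : Set X) ∧
      ((↑) : sigmaRemainder X → StoneCech X) '' K = outerPart (U : Set X) := by
  obtain ⟨hKc, hKo⟩ := hK
  have hc := hKc.image (continuous_subtype_val (p := (· ∈ sigmaRemainder X)))
  obtain ⟨O, hO, rfl⟩ := isOpen_induced_iff.1 hKo
  obtain ⟨M, hM, hMs, hKM⟩ := exists_clopen_of_isCompact_subset hc (by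
    rintro _ ⟨y, -, rfl⟩; exact y.2.1)
  obtain ⟨W, hWM, hW, hCW, hWD⟩ := exists_clopen_separating_stoneCech hX hM hMs hc.isClosed
    ((isClosed_outerPart M).sdiff hO) hKM
    (disjoint_left.2 (by rintro _ ⟨y, hy, rfl⟩ h; exact h.2 hy))
  have hWs : IsSigmaCompact W := hMs.of_isClosed_subset hW.1 hWM
  refine ⟨⟨W, hW⟩, hWs, Subset.antisymm
    (fun z hz => ⟨hCW hz, mem_image_or_not_mem_range hz⟩) fun z hz => ?_⟩
  refine ⟨⟨z, outerPart_subset_sigmaRemainder hWs hz⟩, ?_, rfl⟩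
  by_contra hzO
  exact disjoint_left.1 hWD hz.1 ⟨⟨betaClosure_mono hWM hz.1, hz.2⟩, hzO⟩

theorem isSeparatingFamily_nonemptyCompactOpens (hX : IsZeroDimensional X) :
    IsSeparatingFamily (nonemptyCompactOpens (sigmaRemainder X)) where
  isCompact _ h := h.1
  nonempty _ h := h.2.1
  inter_mem _ hK _ hL h := ⟨hK.1.inter hL.1, h, hK.2.2.inter hL.2.2⟩
  exists_superset C D hC hne hD hd := by
    have hC' := hC.image (continuous_subtype_val (p := (· ∈ sigmaRemainder X)))
    have hD' := hD.image (continuous_subtype_val (p := (· ∈ sigmaRemainder X)))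
    obtain ⟨M, hM, hMs, hCM⟩ := exists_clopen_of_isCompact_subset hC' (by
      rintro _ ⟨y, -, rfl⟩; exact y.2.1)
    obtain ⟨W, hWM, hW, hCW, hWD⟩ := exists_clopen_separating_stoneCech hX hM hMs hC'.isClosed
      hD'.isClosed hCM ((disjoint_image_iff Subtype.val_injective).2 hd)
    obtain ⟨K, hK, h⟩ := exists_compactOpenSet hW (hMs.of_isClosed_subset hW.1 hWM)
    have hCK : C ⊆ K := by
      rw [← image_subset_image_iff Subtype.val_injective, h]
      exact fun z hz => ⟨hCW hz, mem_image_or_not_mem_range hz⟩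
    refine ⟨K, ⟨hK.1, hne.mono hCK, hK.2⟩, hCK, ?_⟩
    rw [← disjoint_image_iff Subtype.val_injective, h]
    exact hWD.mono_left sdiff_subset

theorem nonempty_orderIso_deltaIdeals (hX : IsZeroDimensional X) :
    Nonempty (DeltaIdeals X ≃o (nonemptyCompactOpens (sigmaRemainder X))ᵒᵈ) := by
  have hI : ∀ U : Clopens X, openIdeal (Uᶜ).toOpens = vanishIdeal (outerPart (U : Set X)) :=
    fun U => by
      rw [openIdeal_eq_vanishIdeal, Clopens.coe_toOpens, Clopens.coe_compl, compl_compl]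
  refine nonempty_orderIso_of_range_eq
    (fun K : (nonemptyCompactOpens (sigmaRemainder X))ᵒᵈ =>
      vanishIdeal (Subtype.val '' (OrderDual.ofDual K).1))
    (fun K L => vanishIdeal_image_le_iff (OrderDual.ofDual K).2.1) ?_
  ext I
  constructor
  · rintro ⟨⟨K, hK, hne, hKo⟩, rfl⟩
    obtain ⟨U, hU, h⟩ := exists_clopen_outerPart_eq hX ⟨hK, hKo⟩
    refine ⟨U, hU, fun hc => ?_, by rw [hI, ← h]; rfl⟩
    obtain ⟨z, hz⟩ := hne.image ((↑) : sigmaRemainder X → StoneCech X)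
    rw [h, outerPart, betaClosure_of_isCompact hc] at hz
    exact hz.2 (image_subset_range _ _ hz.1)
  · rintro ⟨U, hUs, hU, rfl⟩
    obtain ⟨K, hK, h⟩ := exists_compactOpenSet U.isClopen hUs
    refine ⟨OrderDual.toDual ⟨K, hK.1, ?_, hK.2⟩, by rw [hI, ← h]; rfl⟩
    rw [← image_nonempty (f := ((↑) : sigmaRemainder X → StoneCech X)), h]
    exact outerPart_nonempty (by rwa [U.isClopen.1.closure_eq])

/-- Here the zero set is the complement of `K` in `βX \ X`; the two order reversals cancel, so no
dual appears. -/
theorem nonempty_orderIso_sigmaIdeals (hX : IsZeroDimensional X) :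
    Nonempty (SigmaIdeals X ≃o compactOpenSets (sigmaRemainder X)) := by
  have hU : ∀ U : Clopens X, outerPart ((U : Set X)ᶜ) =
      (range (stoneCechUnit : X → StoneCech X))ᶜ \ outerPart (U : Set X) := fun U => by
    rw [outerPart, betaClosure_compl U.isClopen]
    ext z
    simp only [outerPart, mem_sdiff, mem_compl_iff]
    tauto
  refine nonempty_orderIso_of_range_eq
    (fun K : compactOpenSets (sigmaRemainder X) => vanishIdeal ((range stoneCechUnit)ᶜ \ (Subtype.val '' (K : Set (sigmaRemainder X)))))
    (fun K L => ?_) ?_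
  · obtain ⟨U, -, h⟩ := exists_clopen_outerPart_eq hX K.2
    rw [vanishIdeal_le_iff (by rw [h, ← hU]; exact isClosed_outerPart _),
      sdiff_subset_sdiff_iff_subset, image_subset_image_iff Subtype.val_injective]
    · rfl
    · exact fun z hz => mem_image_or_not_mem_range hz
    · exact fun z hz => mem_image_or_not_mem_range hz
  ext I
  constructor
  · rintro ⟨K, rfl⟩
    obtain ⟨U, hUs, h⟩ := exists_clopen_outerPart_eq hX K.2
    exact ⟨U, hUs, by rw [openIdeal_eq_vanishIdeal, Clopens.coe_toOpens, hU, ← h]⟩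
  · rintro ⟨U, hUs, rfl⟩
    obtain ⟨K, hK, h⟩ := exists_compactOpenSet U.isClopen hUs
    exact ⟨⟨K, hK⟩, by rw [openIdeal_eq_vanishIdeal, Clopens.coe_toOpens, hU, ← h]⟩

end Paracompact

/-- An order isomorphism between the compact open subsets matches the nonempty ones. -/
theorem nonempty_orderIso_nonemptyCompactOpens {T : Type u} {T' : Type v} [TopologicalSpace T]
    [TopologicalSpace T'] (φ : compactOpenSets T ≃o compactOpenSets T') :
    Nonempty (nonemptyCompactOpens T ≃o nonemptyCompactOpens T') := by
  -- The empty set is the least element, so an order isomorphism must preserve it.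
  have key : ∀ K : compactOpenSets T, (φ K : Set T') = ∅ ↔ (K : Set T) = ∅ := fun K => by
    constructor <;> intro h
    · have h1 : φ K ≤ φ ⟨∅, isCompact_empty, isOpen_empty⟩ := by
        change (φ K : Set T') ⊆ _
        exact h ▸ empty_subset _
      exact subset_empty_iff.1 (φ.le_iff_le.1 h1)
    · have h1 : K ≤ φ.symm ⟨∅, isCompact_empty, isOpen_empty⟩ := by
        change (K : Set T) ⊆ _
        exact h ▸ empty_subset _
      exact subset_empty_iff.1 (φ.le_symm_apply.1 h1)
  exact ⟨{
    toFun := fun K => ⟨φ ⟨K, K.2.1, K.2.2.2⟩, (φ _).2.1,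
      nonempty_iff_ne_empty.2 fun h => K.2.2.1.ne_empty ((key _).1 h), (φ _).2.2⟩
    invFun := fun K => ⟨φ.symm ⟨K, K.2.1, K.2.2.2⟩, (φ.symm _).2.1,
      nonempty_iff_ne_empty.2 fun h => K.2.2.1.ne_empty (by simpa using (key _).2 h), (φ.symm _).2.2⟩
    left_inv := fun K => by
      have h := Subtype.ext_iff.1 (φ.symm_apply_apply ⟨K, K.2.1, K.2.2.2⟩)
      exact Subtype.ext h
    right_inv := fun K => by
      have h := Subtype.ext_iff.1 (φ.apply_symm_apply ⟨K, K.2.1, K.2.2.2⟩)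
      exact Subtype.ext h
    map_rel_iff' := fun {K L} => φ.le_iff_le (x := ⟨K, K.2.1, K.2.2.2⟩)
      (y := ⟨L, L.2.1, L.2.2.2⟩) }⟩

end OnePointIdeals

/-! ### The equivalences -/

theorem theorem7p10 {X : Type*} {Y : Type*} [TopologicalSpace X] [TopologicalSpace Y]
    [T2Space X] [T2Space Y] [LocallyCompactSpace X] [LocallyCompactSpace Y]
    [ParacompactSpace X] [ParacompactSpace Y]
    (hX : ¬ SigmaCompactSpace X) (hY : ¬ SigmaCompactSpace Y) :
    (Nonempty (OnePointIdeals.OmegaIdeals X ≃o OnePointIdeals.OmegaIdeals Y) ↔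
      Nonempty (OnePointIdeals.sigmaRemainder X ≃ₜ OnePointIdeals.sigmaRemainder Y)) ∧
    (OnePointIdeals.IsZeroDimensional X → OnePointIdeals.IsZeroDimensional Y →
      List.TFAE [
        Nonempty (OnePointIdeals.SigmaIdeals X ≃o OnePointIdeals.SigmaIdeals Y),
        Nonempty (OnePointIdeals.DeltaIdeals X ≃o OnePointIdeals.DeltaIdeals Y),
        Nonempty (OnePointIdeals.sigmaRemainder X ≃ₜ OnePointIdeals.sigmaRemainder Y)]) := by
  open OnePointIdeals in
  refine ⟨?_, fun hX0 hY0 => ?_⟩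
  · obtain ⟨a⟩ := nonempty_orderIso_omegaIdeals X
    obtain ⟨b⟩ := nonempty_orderIso_omegaIdeals Y
    constructor
    · rintro ⟨e⟩
      exact (isSeparatingFamily_compactGdeltas _).nonempty_homeomorph
        (isSeparatingFamily_compactGdeltas _) ((a.symm.trans (e.trans b)).dual)
    · rintro ⟨h⟩
      obtain ⟨φ⟩ := nonempty_orderIso_of_homeomorph
        (B := compactGdeltas (sigmaRemainder X)) (B' := compactGdeltas (sigmaRemainder Y)) h
        (fun K hK => ⟨hK.1.image h.continuous, hK.2.1.image h, by
          rw [h.image_eq_preimage_symm]; exact hK.2.2.preimage h.symm.continuous⟩)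
        (fun K hK => ⟨hK.1.image h.symm.continuous, hK.2.1.image h.symm, by
          rw [h.symm.image_eq_preimage_symm]; exact hK.2.2.preimage h.continuous⟩)
      exact ⟨a.trans (φ.dual.trans b.symm)⟩
  · obtain ⟨a⟩ := nonempty_orderIso_sigmaIdeals hX0
    obtain ⟨b⟩ := nonempty_orderIso_sigmaIdeals hY0
    obtain ⟨c⟩ := nonempty_orderIso_deltaIdeals hX0
    obtain ⟨d⟩ := nonempty_orderIso_deltaIdeals hY0
    tfae_have 1 → 2 := by
      rintro ⟨e⟩
      obtain ⟨φ⟩ := nonempty_orderIso_nonemptyCompactOpens (a.symm.trans (e.trans b))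
      exact ⟨c.trans (φ.dual.trans d.symm)⟩
    tfae_have 2 → 3 := by
      rintro ⟨e⟩
      exact (isSeparatingFamily_nonemptyCompactOpens hX0).nonempty_homeomorph
        (isSeparatingFamily_nonemptyCompactOpens hY0) ((c.symm.trans (e.trans d)).dual)
    tfae_have 3 → 1 := by
      rintro ⟨h⟩
      obtain ⟨φ⟩ := nonempty_orderIso_of_homeomorph
        (B := compactOpenSets (sigmaRemainder X)) (B' := compactOpenSets (sigmaRemainder Y)) h
        (fun K hK => ⟨hK.1.image h.continuous, h.isOpenMap _ hK.2⟩)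
        (fun K hK => ⟨hK.1.image h.symm.continuous, h.symm.isOpenMap _ hK.2⟩)
      exact ⟨a.trans (φ.trans b.symm)⟩
    tfae_finish
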